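/- All objects are smooth. Let $M$ be a finite-dimensional manifold (without boundary) and let $h,k\ge 0$ be integers. A pair of $1$-forms $(\alpha_1,\alpha_2)$ on $M$ is a \emph{contact pair} of type $(h,k)$ if $\alpha_1\wedge(d\alpha_1)^h\wedge\alpha_2\wedge(d\alpha_2)^k$ is a volume form (so $\dim M=2h+2k+2$), $(d\alpha_1)^{h+1}=0$ and $(d\alpha_2)^{k+1}=0$. Its Reeb vector fields $Z_1,Z_2$ are the vector fields determined by $\alpha_i(Z_j)=\delta_{ij}$ and $i_{Z_j}d\alpha_i=0$ for $i,j\in\{1,2\}$. The characteristic foliation $\mathcal F_j$ of $\alpha_j$ is the foliation tangent to the distribution $T\mathcal F_j=\ker\alpha_j\cap\ker d\alpha_j$; its leaves are the maximal connected (injectively immersed) integral manifolds of this distribution. Here $d\alpha(X,Y)=X(\alpha(Y))-Y(\alpha(X))-\alpha([X,Y])$. A \emph{metric contact pair} $(\alpha_1,\alpha_2,\phi,g)$ on $M$ consists of a contact pair $(\alpha_1,\alpha_2)$ with Reeb vector fields $Z_1,Z_2$, a field of endomorphisms $\phi$ of $TM$ with $\phi^2=-\mathrm{Id}+\alpha_1\otimes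 Z_1+\alpha_2\otimes Z_2$ and $\phi(Z_1)=\phi(Z_2)=0$, and a Riemannian metric $g$ with $g(X,\phi Y)=(d\alpha_1+d\alpha_2)(X,Y)$ and $g(X,Z_i)=\alpha_i(X)$ for $i=1,2$ and all $X,Y$. The endomorphism field $\phi$ is \emph{decomposable} if $\phi(T\mathcal F_i)\subset T\mathcal F_i$ for $i=1,2$. A \emph{contact metric structure} $(\alpha,Z,\phi,g)$ on a manifold $N$ consists of a contact form $\alpha$ (that is, $\dim N=2n+1$ and $\alpha\wedge(d\alpha)^n$ is a volume form for some $n\ge 0$), its Reeb vector field $Z$ (that is, $\alpha(Z)=1$ and $i_Zd\alpha=0$), a field of endomorphisms $\phi$ of $TN$ with $\phi^2=-\mathrm{Id}+\alpha\otimes Z$ and $\phi(Z)=0$, and a Riemannian metric $g$ with $g(X,\phi Y)=d\alpha(X,Y)$ and $g(X,Z)=\alpha(X)$ for all $X,Y$. \textbf{Theorem.} Let $(\alpha_1,\alpha_2,\phi,g)$ be a metric contact pair on $M$ with Reeb vector fields $Z_1,Z_2$, and suppose that $\phi$ is decomposable. Let $\{i,j\}=\{1,2\}$ and let $\iota:L\to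 M$ be a leaf of the characteristic foliation of $\alpha_j$. Then $Z_i$ and $\phi$ restrict to $L$, that is, there are a vector field $Z'$ and a field of endomorphisms $\phi'$ of $TL$ with $d\iota(Z')=Z_i\circ\iota$ and $d\iota\circ\phi'=\phi\circ d\iota$, and $(\iota^*\alpha_i,Z',\phi',\iota^*g)$ is a contact metric structure on $L$. -/

import Mathlib

open Bundle Set
open scoped Manifold ContDiff

noncomputable section

namespace ContactPairs

universe u v w

section LinearAlgebra

variable {V : Type*} [AddCommGroup V] [Module ℝ V]

/-- The wedge product of two alternating forms (a sum over shuffles, so that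
`(a ∧ b) (v, w) = a v * b w - a w * b v` for covectors `a`, `b`). -/
def wedge {p q : ℕ} (θ : V [⋀^Fin p]→ₗ[ℝ] ℝ) (η : V [⋀^Fin q]→ₗ[ℝ] ℝ) :
    V [⋀^Fin (p + q)]→ₗ[ℝ] ℝ :=
  ((LinearMap.mul' ℝ ℝ).compAlternatingMap (θ.domCoprod η)).domDomCongr finSumFinEquiv

/-- The `n`-th exterior power of a 2-form; the zeroth power is the constant `1`. -/
def wedgePow (θ : V [⋀^Fin 2]→ₗ[ℝ] ℝ) : (n : ℕ) → V [⋀^Fin (2 * n)]→ₗ[ℝ] ℝ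
  | 0 => AlternatingMap.constOfIsEmpty ℝ V (Fin 0) 1
  | n + 1 => wedge (wedgePow θ n) θ

/-- A covector regarded as an alternating form of degree one. -/
def covector (a : V →ₗ[ℝ] ℝ) : V [⋀^Fin 1]→ₗ[ℝ] ℝ :=
  AlternatingMap.ofSubsingleton ℝ V ℝ (0 : Fin 1) a

end LinearAlgebra

section Manifold

variable {E : Type v} [NormedAddCommGroup E] [NormedSpace ℝ E]
  {M : Type u} [TopologicalSpace M] [ChartedSpace E M]

section Forms

/-- Smoothness of a field of covectors, i.e. of a differential 1-form. -/
def IsSmoothOneForm [IsManifold 𝓘(ℝ, E) ∞ M]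
    (α : ∀ x : M, TangentSpace 𝓘(ℝ, E) x →L[ℝ] ℝ) : Prop :=
  ContMDiff 𝓘(ℝ, E) (𝓘(ℝ, E).prod 𝓘(ℝ, E →L[ℝ] ℝ)) ∞
    (fun x ↦ TotalSpace.mk' (E →L[ℝ] ℝ)
      (E := fun x : M ↦ TangentSpace 𝓘(ℝ, E) x →L[ℝ] Trivial M ℝ x) x (α x))

/-- Smoothness of a vector field. -/
def IsSmoothVectorField [IsManifold 𝓘(ℝ, E) ∞ M]
    (Z : ∀ x : M, TangentSpace 𝓘(ℝ, E) x) : Prop :=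
  ContMDiff 𝓘(ℝ, E) (𝓘(ℝ, E).prod 𝓘(ℝ, E)) ∞
    (fun x ↦ TotalSpace.mk' E (E := fun x : M ↦ TangentSpace 𝓘(ℝ, E) x) x (Z x))

/-- Smoothness of a field of endomorphisms of the tangent bundle, i.e. of a tensor field of
type (1,1). -/
def IsSmoothEndomorphismField [IsManifold 𝓘(ℝ, E) ∞ M]
    (φ : ∀ x : M, TangentSpace 𝓘(ℝ, E) x →L[ℝ] TangentSpace 𝓘(ℝ, E) x) : Prop :=
  ContMDiff 𝓘(ℝ, E) (𝓘(ℝ, E).prod 𝓘(ℝ, E →L[ℝ] E)) ∞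
    (fun x ↦ TotalSpace.mk' (E →L[ℝ] E)
      (E := fun x : M ↦ TangentSpace 𝓘(ℝ, E) x →L[ℝ] TangentSpace 𝓘(ℝ, E) x) x (φ x))

/-- The expression of a 1-form in the preferred chart at `x`, as a 1-form on the model space. -/
def formInChart (α : ∀ x : M, TangentSpace 𝓘(ℝ, E) x →L[ℝ] ℝ) (x : M) (y : E) :
    E [⋀^Fin 1]→L[ℝ] ℝ :=
  ContinuousAlternatingMap.ofSubsingleton ℝ E ℝ (0 : Fin 1)
    ((α ((extChartAt 𝓘(ℝ, E) x).symm y)).comp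
      (mfderiv 𝓘(ℝ, E) 𝓘(ℝ, E) (extChartAt 𝓘(ℝ, E) x).symm y))

/-- The exterior derivative of a 1-form: at `x` it is the pullback, under the preferred chart at
`x`, of the exterior derivative of the form read in that chart. It is normalized so that
`dα (X, Y) = X (α Y) - Y (α X) - α [X, Y]`. -/
def extDerivForm (α : ∀ x : M, TangentSpace 𝓘(ℝ, E) x →L[ℝ] ℝ) (x : M) :
    TangentSpace 𝓘(ℝ, E) x [⋀^Fin 2]→L[ℝ] ℝ :=
  (extDeriv (formInChart α x) (extChartAt 𝓘(ℝ, E) x x)).compContinuousLinearMap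
    (mfderiv 𝓘(ℝ, E) 𝓘(ℝ, E) (extChartAt 𝓘(ℝ, E) x) x)

/-- The tangent distribution `ker α ∩ ker dα` of the characteristic foliation of `α`. -/
def charDistribution (α : ∀ x : M, TangentSpace 𝓘(ℝ, E) x →L[ℝ] ℝ) (x : M) :
    Submodule ℝ (TangentSpace 𝓘(ℝ, E) x) where
  carrier := {v | α x v = 0 ∧ ∀ w, extDerivForm α x ![v, w] = 0}
  zero_mem' := by
    refine ⟨map_zero _, fun w ↦ ?_⟩
    exact (extDerivForm α x).map_coord_zero (0 : Fin 2) rfl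
  add_mem' := by
    rintro a b ⟨ha, ha'⟩ ⟨hb, hb'⟩
    refine ⟨by rw [map_add, ha, hb, add_zero], fun w ↦ ?_⟩
    have h := (extDerivForm α x).toAlternatingMap.map_vecCons_add ![w] a b
    exact h.trans (by
      have h1 := ha' w
      have h2 := hb' w
      simpa using congrArg₂ (· + ·) h1 h2)
  smul_mem' := by
    rintro c a ⟨ha, ha'⟩
    refine ⟨by rw [map_smul, ha, smul_zero], fun w ↦ ?_⟩
    have h := (extDerivForm α x).toAlternatingMap.map_vecCons_smul ![w] c a
    exact h.trans (by
      have h1 := ha' w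
      simpa using Or.inr h1)

/-- A field of alternating forms of degree `d` is a volume form if `d` is the dimension and the
form vanishes nowhere. -/
def IsVolumeForm {d : ℕ} (θ : ∀ x : M, TangentSpace 𝓘(ℝ, E) x [⋀^Fin d]→ₗ[ℝ] ℝ) : Prop :=
  Module.finrank ℝ E = d ∧ ∀ x, θ x ≠ 0

end Forms

section Structures

variable [IsManifold 𝓘(ℝ, E) ∞ M]

/-- `α` is a contact form: the manifold has odd dimension `1 + 2 n` and `α ∧ (dα)ⁿ` is a volume
form. -/
structure IsContactForm (α : ∀ x : M, TangentSpace 𝓘(ℝ, E) x →L[ℝ] ℝ) : Prop where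
  smooth : IsSmoothOneForm α
  volume : ∃ n : ℕ, IsVolumeForm fun x ↦
    wedge (covector (α x).toLinearMap) (wedgePow (extDerivForm α x).toAlternatingMap n)

/-- `Z` is the Reeb vector field of the contact form `α`. -/
structure IsReebField (α : ∀ x : M, TangentSpace 𝓘(ℝ, E) x →L[ℝ] ℝ)
    (Z : ∀ x : M, TangentSpace 𝓘(ℝ, E) x) : Prop where
  smooth : IsSmoothVectorField Z
  apply_self : ∀ x, α x (Z x) = 1
  contraction : ∀ x w, extDerivForm α x ![Z x, w] = 0

/-- An almost contact structure `(α, Z, φ)`. -/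
structure IsAlmostContactStructure (α : ∀ x : M, TangentSpace 𝓘(ℝ, E) x →L[ℝ] ℝ)
    (Z : ∀ x : M, TangentSpace 𝓘(ℝ, E) x)
    (φ : ∀ x : M, TangentSpace 𝓘(ℝ, E) x →L[ℝ] TangentSpace 𝓘(ℝ, E) x) : Prop where
  smooth_form : IsSmoothOneForm α
  smooth_field : IsSmoothVectorField Z
  smooth_endo : IsSmoothEndomorphismField φ
  sq : ∀ x v, φ x (φ x v) = -v + α x v • Z x
  map_field : ∀ x, φ x (Z x) = 0
  apply_field : ∀ x, α x (Z x) = 1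

/-- A contact metric structure `(α, Z, φ, g)`: an almost contact structure in which `α` is a
contact form and `Z` its Reeb vector field, with an associated Riemannian metric `g`. -/
structure IsContactMetricStructure (α : ∀ x : M, TangentSpace 𝓘(ℝ, E) x →L[ℝ] ℝ)
    (Z : ∀ x : M, TangentSpace 𝓘(ℝ, E) x)
    (φ : ∀ x : M, TangentSpace 𝓘(ℝ, E) x →L[ℝ] TangentSpace 𝓘(ℝ, E) x)
    (g : ContMDiffRiemannianMetric 𝓘(ℝ, E) ∞ E (fun x : M ↦ TangentSpace 𝓘(ℝ, E) x)) : Prop where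
  almostContact : IsAlmostContactStructure α Z φ
  contact : IsContactForm α
  reeb : IsReebField α Z
  metric_endo : ∀ x v w, g.inner x v (φ x w) = extDerivForm α x ![v, w]
  metric_field : ∀ x v, g.inner x v (Z x) = α x v

/-- `(α₁, α₂)` is a contact pair of type `(h, k)`. -/
structure IsContactPair (h k : ℕ) (α₁ α₂ : ∀ x : M, TangentSpace 𝓘(ℝ, E) x →L[ℝ] ℝ) : Prop where
  smooth₁ : IsSmoothOneForm α₁
  smooth₂ : IsSmoothOneForm α₂
  volume : IsVolumeForm fun x ↦
    wedge
      (wedge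
        (wedge (covector (α₁ x).toLinearMap) (wedgePow (extDerivForm α₁ x).toAlternatingMap h))
        (covector (α₂ x).toLinearMap))
      (wedgePow (extDerivForm α₂ x).toAlternatingMap k)
  pow_eq_zero₁ : ∀ x, wedgePow (extDerivForm α₁ x).toAlternatingMap (h + 1) = 0
  pow_eq_zero₂ : ∀ x, wedgePow (extDerivForm α₂ x).toAlternatingMap (k + 1) = 0

/-- `Z₁`, `Z₂` are the Reeb vector fields of the pair `(α₁, α₂)`. -/
structure IsReebPair (α₁ α₂ : ∀ x : M, TangentSpace 𝓘(ℝ, E) x →L[ℝ] ℝ)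
    (Z₁ Z₂ : ∀ x : M, TangentSpace 𝓘(ℝ, E) x) : Prop where
  smooth₁ : IsSmoothVectorField Z₁
  smooth₂ : IsSmoothVectorField Z₂
  apply₁₁ : ∀ x, α₁ x (Z₁ x) = 1
  apply₂₂ : ∀ x, α₂ x (Z₂ x) = 1
  apply₁₂ : ∀ x, α₁ x (Z₂ x) = 0
  apply₂₁ : ∀ x, α₂ x (Z₁ x) = 0
  contraction₁₁ : ∀ x w, extDerivForm α₁ x ![Z₁ x, w] = 0
  contraction₁₂ : ∀ x w, extDerivForm α₂ x ![Z₁ x, w] = 0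
  contraction₂₁ : ∀ x w, extDerivForm α₁ x ![Z₂ x, w] = 0
  contraction₂₂ : ∀ x w, extDerivForm α₂ x ![Z₂ x, w] = 0

/-- `(α₁, α₂, φ)` is a contact pair structure, where `(α₁, α₂)` is of type `(h, k)` and has Reeb
vector fields `Z₁`, `Z₂`. -/
structure IsContactPairStructure (h k : ℕ) (α₁ α₂ : ∀ x : M, TangentSpace 𝓘(ℝ, E) x →L[ℝ] ℝ)
    (Z₁ Z₂ : ∀ x : M, TangentSpace 𝓘(ℝ, E) x)
    (φ : ∀ x : M, TangentSpace 𝓘(ℝ, E) x →L[ℝ] TangentSpace 𝓘(ℝ, E) x) : Prop where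
  contactPair : IsContactPair h k α₁ α₂
  reeb : IsReebPair α₁ α₂ Z₁ Z₂
  smooth_endo : IsSmoothEndomorphismField φ
  sq : ∀ x v, φ x (φ x v) = -v + α₁ x v • Z₁ x + α₂ x v • Z₂ x
  map_field₁ : ∀ x, φ x (Z₁ x) = 0
  map_field₂ : ∀ x, φ x (Z₂ x) = 0

/-- `(α₁, α₂, φ, g)` is a metric contact pair: a contact pair structure with an associated
Riemannian metric `g`. -/
structure IsMetricContactPair (h k : ℕ) (α₁ α₂ : ∀ x : M, TangentSpace 𝓘(ℝ, E) x →L[ℝ] ℝ)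
    (Z₁ Z₂ : ∀ x : M, TangentSpace 𝓘(ℝ, E) x)
    (φ : ∀ x : M, TangentSpace 𝓘(ℝ, E) x →L[ℝ] TangentSpace 𝓘(ℝ, E) x)
    (g : ContMDiffRiemannianMetric 𝓘(ℝ, E) ∞ E (fun x : M ↦ TangentSpace 𝓘(ℝ, E) x)) : Prop where
  pairStructure : IsContactPairStructure h k α₁ α₂ Z₁ Z₂ φ
  metric_endo : ∀ x v w,
    g.inner x v (φ x w) = (extDerivForm α₁ x + extDerivForm α₂ x) ![v, w]
  metric_field₁ : ∀ x v, g.inner x v (Z₁ x) = α₁ x v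
  metric_field₂ : ∀ x v, g.inner x v (Z₂ x) = α₂ x v

end Structures

/-- `φ` is decomposable: it preserves the tangent distributions of both characteristic
foliations. -/
def IsDecomposable (α₁ α₂ : ∀ x : M, TangentSpace 𝓘(ℝ, E) x →L[ℝ] ℝ)
    (φ : ∀ x : M, TangentSpace 𝓘(ℝ, E) x →L[ℝ] TangentSpace 𝓘(ℝ, E) x) : Prop :=
  (∀ x, ∀ v ∈ charDistribution α₁ x, φ x v ∈ charDistribution α₁ x) ∧
    (∀ x, ∀ v ∈ charDistribution α₂ x, φ x v ∈ charDistribution α₂ x)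

section Leaves

variable {F : Type w} [NormedAddCommGroup F] [NormedSpace ℝ F]
  {L : Type*} [TopologicalSpace L] [ChartedSpace F L]

/-- `ι : L → M` is a connected integral manifold of the distribution `D`: a connected, injectively
immersed submanifold whose tangent space at each of its points is the value of `D`. -/
structure IsIntegralManifold (D : ∀ x : M, Submodule ℝ (TangentSpace 𝓘(ℝ, E) x)) (ι : L → M) :
    Prop where
  connected : ConnectedSpace L
  smooth : ContMDiff 𝓘(ℝ, F) 𝓘(ℝ, E) ∞ ι
  injective : Function.Injective ι
  injective_mfderiv : ∀ p, Function.Injective (mfderiv 𝓘(ℝ, F) 𝓘(ℝ, E) ι p)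
  range_mfderiv : ∀ p,
    LinearMap.range (mfderiv 𝓘(ℝ, F) 𝓘(ℝ, E) ι p).toLinearMap = D (ι p)

/-- `ι : L → M` is a leaf of the foliation tangent to `D`: a maximal connected integral
manifold. -/
structure IsLeaf (D : ∀ x : M, Submodule ℝ (TangentSpace 𝓘(ℝ, E) x)) (ι : L → M) : Prop
    extends IsIntegralManifold (F := F) D ι where
  maximal : ∀ (N : Type u) [TopologicalSpace N] [ChartedSpace F N] [IsManifold 𝓘(ℝ, F) ∞ N]
    (j : N → M), IsIntegralManifold (F := F) D j → range ι ⊆ range j → range j = range ι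

/-- The restriction (pullback) of a 1-form under `ι`. -/
def pullbackForm (ι : L → M) (α : ∀ x : M, TangentSpace 𝓘(ℝ, E) x →L[ℝ] ℝ) (p : L) :
    TangentSpace 𝓘(ℝ, F) p →L[ℝ] ℝ :=
  (α (ι p)).comp (mfderiv 𝓘(ℝ, F) 𝓘(ℝ, E) ι p)

/-- `(α, Z, φ, g)` induces a contact metric structure on the immersed submanifold `ι : L → M`:
`Z` and `φ` restrict to a vector field and a field of endomorphisms of `L`, and together with the
restrictions of `α` and `g` these form a contact metric structure. -/
def InducesContactMetricStructure [IsManifold 𝓘(ℝ, E) ∞ M] [IsManifold 𝓘(ℝ, F) ∞ L]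
    (ι : L → M)
    (α : ∀ x : M, TangentSpace 𝓘(ℝ, E) x →L[ℝ] ℝ)
    (Z : ∀ x : M, TangentSpace 𝓘(ℝ, E) x)
    (φ : ∀ x : M, TangentSpace 𝓘(ℝ, E) x →L[ℝ] TangentSpace 𝓘(ℝ, E) x)
    (g : ContMDiffRiemannianMetric 𝓘(ℝ, E) ∞ E (fun x : M ↦ TangentSpace 𝓘(ℝ, E) x)) : Prop :=
  ∃ (Z' : ∀ p : L, TangentSpace 𝓘(ℝ, F) p)
    (φ' : ∀ p : L, TangentSpace 𝓘(ℝ, F) p →L[ℝ] TangentSpace 𝓘(ℝ, F) p)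
    (g' : ContMDiffRiemannianMetric 𝓘(ℝ, F) ∞ F (fun p : L ↦ TangentSpace 𝓘(ℝ, F) p)),
    (∀ p, mfderiv 𝓘(ℝ, F) 𝓘(ℝ, E) ι p (Z' p) = Z (ι p)) ∧
    (∀ p v, mfderiv 𝓘(ℝ, F) 𝓘(ℝ, E) ι p (φ' p v) =
      φ (ι p) (mfderiv 𝓘(ℝ, F) 𝓘(ℝ, E) ι p v)) ∧
    (∀ p v w, g'.inner p v w =
      g.inner (ι p) (mfderiv 𝓘(ℝ, F) 𝓘(ℝ, E) ι p v) (mfderiv 𝓘(ℝ, F) 𝓘(ℝ, E) ι p w)) ∧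
    IsContactMetricStructure (pullbackForm ι α) Z' φ' g'

end Leaves

end Manifold

end ContactPairs

end

/-! Along the characteristic foliation of `α_j` the form `dα_j` is annihilated by tangent vectors,
so `g(X, φY) = (dα₁ + dα₂)(X, Y)` reduces to `g(X, φY) = dα_i(X, Y)`, and the term `α_j ⊗ Z_j` drops
out of `φ²`. The field `Z_i` is tangent because `α_j(Z_i) = 0` and `i_{Z_i} dα_j = 0`, and `φ`
preserves tangency by decomposability. Hence every algebraic identity of a contact metric structure
restricts to the leaf.

What remains is that `α = ι^*α_i` is a contact form. If `α(v) = 0` and `dα(v, ·) = 0` on the leaf,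
then `0 = dα(v, φv) = g(v, φ²v) = -g(v, v)`, so `v = 0`. Thus `dα` is nondegenerate on `ker α`, and
`exists_wedge_covector_wedgePow_ne_zero` turns this into odd dimension and `α ∧ (dα)ⁿ ≠ 0` by
evaluating on the Reeb vector followed by a symplectic basis.

The analytic input is that `d` commutes with pullback (`extDerivForm_pullbackForm`) and that tensor
fields tangent to an immersed submanifold restrict smoothly, through a smooth local left inverse of
`dι` (`exists_contMDiffAt_leftInverse`). `IsIntegralManifold.inducesContactMetricStructure`
assembles these. -/

noncomputable section

namespace ContactPairs

/-! ### Wedge powers as antisymmetrized tensor powers. -/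

section ExteriorAlgebra

variable {V : Type*} [AddCommGroup V] [Module ℝ V]

/-- The product of two real-valued multilinear maps, in consecutive groups of variables. -/
def mulMultilinear {p q : ℕ} (a : MultilinearMap ℝ (fun _ : Fin p ↦ V) ℝ)
    (b : MultilinearMap ℝ (fun _ : Fin q ↦ V) ℝ) :
    MultilinearMap ℝ (fun _ : Fin (p + q) ↦ V) ℝ :=
  ((LinearMap.mul' ℝ ℝ).compMultilinearMap (a.domCoprod b)).domDomCongr finSumFinEquiv

lemma mulMultilinear_apply {p q : ℕ} (a : MultilinearMap ℝ (fun _ : Fin p ↦ V) ℝ)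
    (b : MultilinearMap ℝ (fun _ : Fin q ↦ V) ℝ) (v : Fin (p + q) → V) :
    mulMultilinear a b v = a (fun i ↦ v (Fin.castAdd q i)) * b (fun j ↦ v (Fin.natAdd p j)) := by
  simp [mulMultilinear]

lemma alternatization_domDomCongr {ι κ : Type*} [Fintype ι] [DecidableEq ι] [Fintype κ]
    [DecidableEq κ] (e : ι ≃ κ) (m : MultilinearMap ℝ (fun _ : ι ↦ V) ℝ) :
    MultilinearMap.alternatization (m.domDomCongr e) =
      (MultilinearMap.alternatization m).domDomCongr e := by
  ext v
  simp only [MultilinearMap.alternatization_apply, AlternatingMap.domDomCongr_apply]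
  refine (Fintype.sum_equiv e.permCongr _ _ fun σ ↦ ?_).symm
  rw [Equiv.Perm.sign_permCongr]
  congr 1
  simp only [MultilinearMap.domDomCongr_apply]
  congr 1
  ext i
  simp

/-- Antisymmetrizing inside each block and then summing over shuffles runs through every permutation
once, so no factorials appear. This replaces shuffles by sums over full permutation groups. -/
lemma wedge_alternatization {p q : ℕ} (a : MultilinearMap ℝ (fun _ : Fin p ↦ V) ℝ)
    (b : MultilinearMap ℝ (fun _ : Fin q ↦ V) ℝ) :
    wedge (MultilinearMap.alternatization a) (MultilinearMap.alternatization b) =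
      MultilinearMap.alternatization (mulMultilinear a b) := by
  rw [mulMultilinear, alternatization_domDomCongr, LinearMap.compMultilinearMap_alternatization,
    MultilinearMap.domCoprod_alternization, wedge]

lemma wedge_smul_left {p q : ℕ} (c : ℝ) (a : V [⋀^Fin p]→ₗ[ℝ] ℝ) (b : V [⋀^Fin q]→ₗ[ℝ] ℝ) :
    wedge (c • a) b = c • wedge a b := by
  ext v
  simp only [wedge, ← AlternatingMap.domCoprod'_apply, ← TensorProduct.smul_tmul', map_smul]
  simp

lemma wedge_smul_right {p q : ℕ} (c : ℝ) (a : V [⋀^Fin p]→ₗ[ℝ] ℝ) (b : V [⋀^Fin q]→ₗ[ℝ] ℝ) :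
    wedge a (c • b) = c • wedge a b := by
  ext v
  simp only [wedge, ← AlternatingMap.domCoprod'_apply, TensorProduct.tmul_smul, map_smul]
  simp

/-- The `n`-th tensor power of a 2-form. -/
def tensorPow (θ : V [⋀^Fin 2]→ₗ[ℝ] ℝ) :
    (n : ℕ) → MultilinearMap ℝ (fun _ : Fin (2 * n) ↦ V) ℝ
  | 0 => (AlternatingMap.constOfIsEmpty ℝ V (Fin 0) (1 : ℝ)).toMultilinearMap
  | n + 1 => mulMultilinear (tensorPow θ n) θ.toMultilinearMap

lemma tensorPow_apply (θ : V [⋀^Fin 2]→ₗ[ℝ] ℝ) (n : ℕ) (v : Fin (2 * n) → V) :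
    tensorPow θ n v = ∏ i : Fin n,
      θ ![v ⟨2 * i, by omega⟩, v ⟨2 * i + 1, by omega⟩] := by
  induction n with
  | zero => rfl
  | succ n ih =>
    rw [Fin.prod_univ_castSucc]
    refine (mulMultilinear_apply (tensorPow θ n) θ.toMultilinearMap v).trans ?_
    rw [ih]
    congr 1
    change θ _ = θ _
    congr 1
    ext i
    fin_cases i <;> rfl

/-- Each factor `θ` contributes a `2`, since the unnormalized antisymmetrization of an alternating
2-form is `2! • θ`. -/
lemma smul_wedgePow (θ : V [⋀^Fin 2]→ₗ[ℝ] ℝ) (n : ℕ) :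
    (2 : ℝ) ^ n • wedgePow θ n = MultilinearMap.alternatization (tensorPow θ n) := by
  induction n with
  | zero =>
    have := AlternatingMap.coe_alternatization (AlternatingMap.constOfIsEmpty ℝ V (Fin 0) (1 : ℝ))
    simp only [Fintype.card_fin, Nat.factorial_zero, one_smul] at this
    rw [pow_zero, one_smul]
    exact this.symm
  | succ n ih =>
    have h2 : MultilinearMap.alternatization θ.toMultilinearMap = (2 : ℝ) • θ := by
      have := AlternatingMap.coe_alternatization θ
      simp only [Fintype.card_fin] at this
      refine this.trans ?_
      ext v
      simp [Nat.factorial]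
    refine Eq.trans ?_ (wedge_alternatization (tensorPow θ n) θ.toMultilinearMap)
    rw [← ih, h2, wedge_smul_left, wedge_smul_right, smul_smul, pow_succ]
    rfl

lemma smul_wedge_covector_wedgePow_apply (a : V →ₗ[ℝ] ℝ) (θ : V [⋀^Fin 2]→ₗ[ℝ] ℝ) (n : ℕ)
    (v : Fin (1 + 2 * n) → V) :
    (2 : ℝ) ^ n * wedge (covector a) (wedgePow θ n) v =
      ∑ σ : Equiv.Perm (Fin (1 + 2 * n)), (Equiv.Perm.sign σ : ℤ) * (a (v (σ ⟨0, by omega⟩)) *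
        ∏ i : Fin n, θ ![v (σ ⟨1 + 2 * i, by omega⟩), v (σ ⟨1 + (2 * i + 1), by omega⟩)]) := by
  have h1 : MultilinearMap.alternatization (covector a).toMultilinearMap = covector a := by
    refine (AlternatingMap.coe_alternatization (covector a)).trans ?_
    simp
  have h := wedge_alternatization (covector a).toMultilinearMap (tensorPow θ n)
  rw [h1, ← smul_wedgePow, wedge_smul_right] at h
  have h' := congrArg (fun f ↦ f v) h
  simp only [AlternatingMap.smul_apply, smul_eq_mul, MultilinearMap.alternatization_apply] at h'
  rw [h']
  refine Finset.sum_congr rfl fun σ _ ↦ ?_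
  rw [MultilinearMap.domDomCongr_apply, mulMultilinear_apply, tensorPow_apply, Units.smul_def,
    zsmul_eq_mul]
  rfl

end ExteriorAlgebra

/-! ### Signs of permutations against the standard symplectic matrix. -/

section Permutations

/-- The matrix of the standard symplectic form in a basis indexed by `Fin n × Fin 2`. -/
def stdSymplectic {n : ℕ} (p q : Fin n × Fin 2) : ℝ :=
  if p.1 = q.1 then ((q.2 : ℕ) : ℝ) - ((p.2 : ℕ) : ℝ) else 0

/-- A nonzero product forces `σ` to map pairs `{(i, 0), (i, 1)}` to pairs, so `σ` is a permutation
`ρ` of the pairs composed with permutations `τ i` inside them. The permutation `ρ` acts on two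
copies of `Fin n` and has total sign `1`, while the matrix entries are the signs of the `τ i`. The
signed product is therefore a product of squares. -/
lemma sign_mul_prod_stdSymplectic_nonneg {n : ℕ} (σ : Equiv.Perm (Fin n × Fin 2)) :
    0 ≤ ((Equiv.Perm.sign σ : ℤ) : ℝ) * ∏ i, stdSymplectic (σ (i, 0)) (σ (i, 1)) := by
  by_cases h0 : ∏ i, stdSymplectic (σ (i, 0)) (σ (i, 1)) = 0
  · rw [h0, mul_zero]
  have h1 : ∀ i, (σ (i, 0)).1 = (σ (i, 1)).1 := fun i ↦ by
    by_contra hne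
    exact h0 (Finset.prod_eq_zero (Finset.mem_univ i) (if_neg hne))
  have h1' : ∀ i b, (σ (i, b)).1 = (σ (i, 0)).1 := fun i b ↦ by
    fin_cases b
    · rfl
    · exact (h1 i).symm
  have hsurj : Function.Surjective fun i ↦ (σ (i, 0)).1 := fun j ↦ by
    refine ⟨(σ.symm (j, 0)).1, ?_⟩
    change (σ ((σ.symm (j, 0)).1, 0)).1 = j
    rw [← h1' _ (σ.symm (j, 0)).2]
    simp
  let ρ : Equiv.Perm (Fin n) := Equiv.ofBijective _ (Finite.surjective_iff_bijective.mp hsurj)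
  have hinj : ∀ i, Function.Injective fun b ↦ (σ (i, b)).2 := fun i b c hbc ↦ by
    have : σ (i, b) = σ (i, c) := Prod.ext ((h1' i b).trans (h1' i c).symm) hbc
    simpa using σ.injective this
  let τ : Fin n → Equiv.Perm (Fin 2) := fun i ↦
    Equiv.ofBijective _ (Finite.injective_iff_bijective.mp (hinj i))
  have hσ : σ = (Equiv.prodCongrLeft fun _ : Fin 2 ↦ ρ) * Equiv.prodCongrRight τ := by
    ext ⟨i, b⟩ : 1
    exact Prod.ext (h1' i b) rfl
  have hτ : ∀ t : Equiv.Perm (Fin 2),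
      (((t 1 : Fin 2) : ℕ) : ℤ) - ((t 0 : Fin 2) : ℕ) = Equiv.Perm.sign t := by decide
  have hsign : (Equiv.Perm.sign σ : ℤ) = ∏ i, (Equiv.Perm.sign (τ i) : ℤ) := by
    rw [hσ, Equiv.Perm.sign_mul, Equiv.Perm.sign_prodCongrRight, Equiv.Perm.sign_prodCongrLeft]
    simp [Int.units_sq]
  rw [hsign]
  push_cast
  rw [← Finset.prod_mul_distrib]
  refine Finset.prod_nonneg fun i _ ↦ ?_
  rw [stdSymplectic, if_pos (h1 i)]
  have := congrArg (Int.cast : ℤ → ℝ) (hτ (τ i))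
  push_cast at this
  change 0 ≤ _ * ((((τ i) 1 : Fin 2) : ℕ) - (((τ i) 0 : Fin 2) : ℕ) : ℝ)
  rw [this]
  exact mul_self_nonneg _

/-- No cancellation occurs: a term vanishes unless `σ` fixes the `Unit` slot, the other terms are
nonnegative by the previous lemma, and the identity contributes `1`. -/
lemma sum_sign_stdSymplectic_pos {n : ℕ} (a : Unit ⊕ Fin n × Fin 2 → ℝ)
    (w : Unit ⊕ Fin n × Fin 2 → Unit ⊕ Fin n × Fin 2 → ℝ) (ha : a (Sum.inl ()) = 1)
    (ha' : ∀ p, a (Sum.inr p) = 0) (hw : ∀ p q, w (Sum.inr p) (Sum.inr q) = stdSymplectic p q) :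
    0 < ∑ σ : Equiv.Perm (Unit ⊕ Fin n × Fin 2), ((Equiv.Perm.sign σ : ℤ) : ℝ) *
      (a (σ (Sum.inl ())) * ∏ i, w (σ (Sum.inr (i, 0))) (σ (Sum.inr (i, 1)))) := by
  refine Finset.sum_pos' (fun σ _ ↦ ?_) ⟨1, Finset.mem_univ _, ?_⟩
  · rcases hσ : σ (Sum.inl ()) with u | p
    · have hmaps : Set.MapsTo σ (Set.range Sum.inl) (Set.range Sum.inl) := by
        rintro _ ⟨u', rfl⟩
        exact ⟨u, hσ.symm⟩
      obtain ⟨⟨τ₁, τ₂⟩, rfl⟩ := Equiv.Perm.mem_sumCongrHom_range_of_perm_mapsTo_inl hmaps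
      have := sign_mul_prod_stdSymplectic_nonneg τ₂
      have hτ₁ : τ₁ = 1 := Subsingleton.elim _ _
      simpa [ha, hw, hτ₁] using this
    · rw [ha']
      simp
  · simp [ha, hw, stdSymplectic]

end Permutations

/-! ### Symplectic bases and nonvanishing of the top form. -/

section Symplectic

variable {V : Type*} [AddCommGroup V] [Module ℝ V]

/-- The position of the basis vectors of `Unit ⊕ Fin n × Fin 2` in the list `Fin (1 + 2 * n)`. -/
def blockEquiv (n : ℕ) : Unit ⊕ Fin n × Fin 2 ≃ Fin (1 + 2 * n) :=
  ((Equiv.ofUnique Unit (Fin 1)).sumCongr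
    (finProdFinEquiv.trans (finCongr (mul_comm n 2)))).trans finSumFinEquiv

lemma blockEquiv_inr (n : ℕ) (i : Fin n) (b : Fin 2) :
    (blockEquiv n (Sum.inr (i, b)) : ℕ) = 1 + (2 * i + b) := by
  simp [blockEquiv, add_comm]

lemma wedge_covector_wedgePow_ne_zero (a : V →ₗ[ℝ] ℝ) (θ : V [⋀^Fin 2]→ₗ[ℝ] ℝ) {n : ℕ}
    {z : V} {x : Fin n × Fin 2 → V} (hz : a z = 1) (hx : ∀ p, a (x p) = 0)
    (hθ : ∀ p q, θ ![x p, x q] = stdSymplectic p q) :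
    wedge (covector a) (wedgePow θ n) ≠ 0 := by
  intro h0
  let y : Unit ⊕ Fin n × Fin 2 → V := Sum.elim (fun _ ↦ z) x
  have h := smul_wedge_covector_wedgePow_apply a θ n (y ∘ (blockEquiv n).symm)
  have hpos := sum_sign_stdSymplectic_pos (fun p ↦ a (y p)) (fun p q ↦ θ ![y p, y q]) hz hx hθ
  rw [h0, AlternatingMap.zero_apply, mul_zero] at h
  rw [← Equiv.sum_comp (blockEquiv n).permCongr] at h
  refine hpos.ne (h.trans (Finset.sum_congr rfl fun σ _ ↦ ?_))
  have e0 : (⟨0, by omega⟩ : Fin (1 + 2 * n)) = blockEquiv n (Sum.inl ()) := by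
    simp [blockEquiv, Fin.ext_iff]
  have e1 (i : Fin n) : (⟨1 + 2 * i, by omega⟩ : Fin (1 + 2 * n)) =
      blockEquiv n (Sum.inr (i, 0)) := by
    simp [Fin.ext_iff, blockEquiv_inr]
  have e2 (i : Fin n) : (⟨1 + (2 * i + 1), by omega⟩ : Fin (1 + 2 * n)) =
      blockEquiv n (Sum.inr (i, 1)) := by
    simp [Fin.ext_iff, blockEquiv_inr]
  simp only [e0, e1, e2, Equiv.Perm.sign_permCongr, Function.comp_apply, Equiv.permCongr_apply,
    Equiv.symm_apply_apply]

/-- Symplectic Gram–Schmidt: split off a hyperbolic plane spanned by `e`, `f` with `B e f = 1` and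
recurse on its `B`-orthogonal complement. The space `V` is quantified after `d` so that the
induction can pass to a subspace. -/
lemma exists_symplectic_basis (d : ℕ) : ∀ (V : Type*) [AddCommGroup V] [Module ℝ V]
    [FiniteDimensional ℝ V] (B : V →ₗ[ℝ] V →ₗ[ℝ] ℝ), (∀ v, B v v = 0) →
    (∀ v, (∀ w, B v w = 0) → v = 0) → Module.finrank ℝ V = d →
    ∃ (n : ℕ) (x : Fin n × Fin 2 → V), d = 2 * n ∧ ∀ p q, B (x p) (x q) = stdSymplectic p q := by
  induction d using Nat.strong_induction_on with
  | _ d ih =>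
  intro V _ _ _ B halt hsep hd
  rcases Nat.eq_zero_or_pos d with rfl | hpos
  · exact ⟨0, fun p ↦ p.1.elim0, rfl, fun p ↦ p.1.elim0⟩
  have hanti (v w : V) : B v w = -B w v := by
    have := halt (v + w)
    simp only [map_add, LinearMap.add_apply, halt] at this
    linarith
  have : Nontrivial V := Module.nontrivial_of_finrank_pos (R := ℝ) (hd ▸ hpos)
  obtain ⟨e, he⟩ := exists_ne (0 : V)
  obtain ⟨f', hf'⟩ : ∃ w, B e w ≠ 0 := by
    by_contra! h
    exact he (hsep e h)
  obtain ⟨f, hf⟩ : ∃ f, B e f = 1 := ⟨(B e f')⁻¹ • f', by simp [hf']⟩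
  have hfe : B f e = -1 := by rw [hanti, hf]
  -- The kernel of `T` is the orthogonal complement of `e` and `f`; surjectivity of `T` gives it
  -- codimension two.
  let T : V →ₗ[ℝ] ℝ × ℝ := (B e).prod (B f)
  have hT : Function.Surjective T := fun ⟨s, t⟩ ↦ ⟨s • f - t • e, by simp [T, hf, hfe, halt]⟩
  have hrank := LinearMap.finrank_range_add_finrank_ker T
  rw [LinearMap.range_eq_top.mpr hT, finrank_top, Module.finrank_prod, Module.finrank_self, hd]
    at hrank
  let W : Submodule ℝ V := LinearMap.ker T
  have hW (w : W) : B e w = 0 ∧ B f w = 0 := 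
    ⟨congrArg Prod.fst (LinearMap.mem_ker.mp w.2), congrArg Prod.snd (LinearMap.mem_ker.mp w.2)⟩
  obtain ⟨n, x, hn, hx⟩ := ih (d - 2) (by omega) W (B.domRestrict₁₂ W W) (fun v ↦ halt v)
    (fun w hw ↦ by
      refine Subtype.ext (hsep w fun v ↦ ?_)
      -- This is the projection of `v` to `W` along the plane of `e` and `f`. As `w` is orthogonal
      -- to that plane, `B w v` can be tested on `W` alone.
      have hv : v - B e v • f + B f v • e ∈ W := by simp [W, T, hf, hfe, halt]
      have : B w (v - B e v • f + B f v • e) = 0 := hw ⟨_, hv⟩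
      simpa [hanti w f, hanti w e, hW w] using this) (by change Module.finrank ℝ (LinearMap.ker T) = d - 2; omega)
  refine ⟨n + 1, fun p ↦ Fin.cases (if p.2 = 0 then e else f) (fun i ↦ (x (i, p.2) : V)) p.1,
    by omega, ?_⟩
  rintro ⟨i, b⟩ ⟨j, c⟩
  induction i using Fin.cases with
  | zero =>
    induction j using Fin.cases with
    | zero => fin_cases b <;> fin_cases c <;> simp [stdSymplectic, halt, hf, hfe]
    | succ j =>
      have := hW (x (j, c))
      fin_cases b <;> simp [stdSymplectic, this, (Fin.succ_ne_zero j).symm]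
  | succ i =>
    induction j using Fin.cases with
    | zero =>
      have := hW (x (i, b))
      fin_cases c <;> simp [stdSymplectic, hanti (x (i, b)), this]
    | succ j =>
      have : B (x (i, b)) (x (j, c)) = _ := hx (i, b) (j, c)
      simpa [stdSymplectic] using this

/-- A 2-form that is nondegenerate on the kernel of a covector `a` and has in its kernel a vector
on which `a` is nonzero has an exterior power whose product with `a` is a volume form. -/
lemma exists_wedge_covector_wedgePow_ne_zero [FiniteDimensional ℝ V] (a : V →ₗ[ℝ] ℝ)
    (θ : V [⋀^Fin 2]→ₗ[ℝ] ℝ) {z : V} (hz : a z = 1) (hθz : ∀ w, θ ![z, w] = 0)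
    (hθ : ∀ v, a v = 0 → (∀ w, θ ![v, w] = 0) → v = 0) :
    ∃ n, Module.finrank ℝ V = 1 + 2 * n ∧ wedge (covector a) (wedgePow θ n) ≠ 0 := by
  have hup (v w w' : V) : Function.update ![v, w] 1 w' = ![v, w'] := by
    ext i
    fin_cases i <;> rfl
  let B : V →ₗ[ℝ] V →ₗ[ℝ] ℝ := LinearMap.mk₂ ℝ (fun v w ↦ θ ![v, w])
    (fun v v' w ↦ θ.map_vecCons_add ![w] v v') (fun c v w ↦ θ.map_vecCons_smul ![w] c v)
    (fun v w w' ↦ by simpa only [hup] using θ.map_update_add ![v, v] 1 w w')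
    (fun c v w ↦ by simpa only [hup] using θ.map_update_smul ![v, v] 1 c w)
  have halt (v : V) : B v v = 0 := θ.map_eq_zero_of_eq ![v, v] (i := 0) (j := 1) rfl (by simp)
  have hanti (v w : V) : B v w = -B w v := by
    have := halt (v + w)
    simp only [map_add, LinearMap.add_apply, halt] at this
    linarith
  have hrank := LinearMap.finrank_range_add_finrank_ker a
  rw [LinearMap.range_eq_top.mpr (LinearMap.surjective fun h ↦ by simp [h] at hz), finrank_top,
    Module.finrank_self] at hrank
  obtain ⟨n, x, hn, hx⟩ := exists_symplectic_basis _ (LinearMap.ker a)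
    (B.domRestrict₁₂ _ _) (fun v ↦ halt v) (fun v hv ↦ by
      refine Subtype.ext (hθ v v.2 fun w ↦ ?_)
      -- Projecting along `z` lands in `ker a` and does not change the pairing with `v`, because `z`
      -- lies in the kernel of `θ`.
      have hw : w - a w • z ∈ LinearMap.ker a := by simp [hz]
      have h1 : B v (w - a w • z) = 0 := hv ⟨_, hw⟩
      have h2 : B v z = 0 := by rw [hanti, show B z v = 0 from hθz v, neg_zero]
      change B v w = 0
      rwa [map_sub, map_smul, h2, smul_zero, sub_zero] at h1) rfl
  exact ⟨n, by omega, wedge_covector_wedgePow_ne_zero a θ (x := fun p ↦ (x p : V)) hz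
    (fun p ↦ (x p).2) hx⟩

end Symplectic

/-! ### Naturality of the exterior derivative. -/

section Pullback

open Filter Topology

variable {E : Type*} [NormedAddCommGroup E] [NormedSpace ℝ E]
  {M : Type*} [TopologicalSpace M] [ChartedSpace E M] [IsManifold 𝓘(ℝ, E) ∞ M]

/-- A covector at `x`, regarded as a functional on the model space. -/
def covectorToModel (α : ∀ x : M, TangentSpace 𝓘(ℝ, E) x →L[ℝ] ℝ) (x : M) : E →L[ℝ] ℝ := α x

lemma mdifferentiableAt_extChartAt_symm {x : M} {y : E} (hy : y ∈ (extChartAt 𝓘(ℝ, E) x).target) :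
    MDifferentiableAt 𝓘(ℝ, E) 𝓘(ℝ, E) (extChartAt 𝓘(ℝ, E) x).symm y := by
  have := mdifferentiableWithinAt_extChartAt_symm hy
  rwa [ModelWithCorners.range_eq_univ, mdifferentiableWithinAt_univ] at this

lemma contMDiffAt_extChartAt_symm {x : M} {y : E} (hy : y ∈ (extChartAt 𝓘(ℝ, E) x).target) :
    ContMDiffAt 𝓘(ℝ, E) 𝓘(ℝ, E) ∞ (extChartAt 𝓘(ℝ, E) x).symm y :=
  (contMDiffOn_extChartAt_symm x).contMDiffAt (extChartAt_target_mem_nhds' hy)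

/-- The inverse of the tangent trivialization is the derivative of the inverse chart, so
`formInChart` is the bundle coordinate expression of `α` read through that chart. -/
lemma IsSmoothOneForm.contDiffAt_formInChart {α : ∀ x : M, TangentSpace 𝓘(ℝ, E) x →L[ℝ] ℝ}
    (hα : IsSmoothOneForm α) (x : M) :
    ContDiffAt ℝ ∞ (formInChart α x) (extChartAt 𝓘(ℝ, E) x x) := by
  have h := ((contMDiffAt_hom_bundle _).mp (hα x)).2
  have hs := contMDiffAt_extChartAt_symm (mem_extChartAt_target (I := 𝓘(ℝ, E)) x)
  have h' := (h.comp_of_eq hs (extChartAt_to_inv x)).contDiffAt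
  refine ((ContinuousAlternatingMap.ofSubsingletonLIE (𝕜 := ℝ) (E := E) (F := ℝ)
    (0 : Fin 1)).contDiff.contDiffAt.comp _ h').congr_of_eventuallyEq ?_
  filter_upwards [extChartAt_target_mem_nhds (I := 𝓘(ℝ, E)) x] with y hy
  simp only [Function.comp_apply, formInChart]
  refine congrArg (ContinuousAlternatingMap.ofSubsingleton ℝ E ℝ (0 : Fin 1)) ?_
  have hy' : (extChartAt 𝓘(ℝ, E) x).symm y ∈ (chartAt E x).source := by
    simpa using (extChartAt 𝓘(ℝ, E) x).map_target hy
  have e : (trivializationAt E (TangentSpace 𝓘(ℝ, E)) x).symmL ℝ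
      ((extChartAt 𝓘(ℝ, E) x).symm y) =
      mfderiv 𝓘(ℝ, E) 𝓘(ℝ, E) (extChartAt 𝓘(ℝ, E) x).symm y := by
    rw [TangentBundle.symmL_trivializationAt hy', ModelWithCorners.range_eq_univ,
      mfderivWithin_univ]
    exact congrArg (fun z ↦ (show E →L[ℝ] E from
      mfderiv 𝓘(ℝ, E) 𝓘(ℝ, E) (extChartAt 𝓘(ℝ, E) x).symm z))
      ((extChartAt 𝓘(ℝ, E) x).right_inv hy)
  ext v
  have e' := congrArg (fun T ↦ α ((extChartAt 𝓘(ℝ, E) x).symm y) (T v)) e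
  refine e'.symm.trans ?_
  simp [ContinuousLinearMap.inCoordinates]
  rfl

variable {F : Type*} [NormedAddCommGroup F] [NormedSpace ℝ F]
  {L : Type*} [TopologicalSpace L] [ChartedSpace F L] [IsManifold 𝓘(ℝ, F) ∞ L]

/-- The exterior derivative commutes with pullback. -/
lemma extDerivForm_pullbackForm {α : ∀ x : M, TangentSpace 𝓘(ℝ, E) x →L[ℝ] ℝ}
    (hα : IsSmoothOneForm α) {ι : L → M} (hι : ContMDiff 𝓘(ℝ, F) 𝓘(ℝ, E) ∞ ι) (p : L) :
    extDerivForm (pullbackForm (F := F) ι α) p =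
      (extDerivForm α (ι p)).compContinuousLinearMap (mfderiv 𝓘(ℝ, F) 𝓘(ℝ, E) ι p) := by
  set f : F → E := extChartAt 𝓘(ℝ, E) (ι p) ∘ ι ∘ (extChartAt 𝓘(ℝ, F) p).symm with hf
  set y₀ := extChartAt 𝓘(ℝ, F) p p with hy₀
  have hy₀t : y₀ ∈ (extChartAt 𝓘(ℝ, F) p).target := mem_extChartAt_target p
  have hinv : (extChartAt 𝓘(ℝ, F) p).symm y₀ = p := extChartAt_to_inv p
  have hfy₀ : f y₀ = extChartAt 𝓘(ℝ, E) (ι p) (ι p) := by simp only [hf, Function.comp_apply, hinv]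
  have hιψ : ContMDiffAt 𝓘(ℝ, F) 𝓘(ℝ, E) ∞ (ι ∘ (extChartAt 𝓘(ℝ, F) p).symm) y₀ :=
    (hι _).comp _ (contMDiffAt_extChartAt_symm hy₀t)
  have hfs : ContMDiffAt 𝓘(ℝ, F) 𝓘(ℝ, E) ∞ f y₀ := by
    refine ContMDiffAt.comp y₀ (g := extChartAt 𝓘(ℝ, E) (ι p)) ?_ hιψ
    rw [Function.comp_apply, hinv]
    exact contMDiffAt_extChartAt
  have hev : ∀ᶠ y in 𝓝 y₀, y ∈ (extChartAt 𝓘(ℝ, F) p).target ∧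
      ι ((extChartAt 𝓘(ℝ, F) p).symm y) ∈ (extChartAt 𝓘(ℝ, E) (ι p)).source := by
    refine Filter.Eventually.and (extChartAt_target_mem_nhds p) (hιψ.continuousAt ?_)
    rw [Function.comp_apply, hinv]
    exact extChartAt_source_mem_nhds (ι p)
  -- In charts the pulled-back form is the pullback by the local representative `f` of `ι`, which
  -- reduces the claim to `extDeriv_pullback` between vector spaces.
  have hform : formInChart (pullbackForm (F := F) ι α) p =ᶠ[𝓝 y₀] fun y ↦
      (formInChart α (ι p) (f y)).compContinuousLinearMap (fderiv ℝ f y) := by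
    -- The chart conditions are needed on a neighbourhood of `y`, since derivatives at `y` are
    -- compared below.
    filter_upwards [hev.eventually_nhds] with y hy
    obtain ⟨hyt, hys⟩ := hy.self_of_nhds
    have hx : (extChartAt 𝓘(ℝ, E) (ι p)).symm (f y) = ι ((extChartAt 𝓘(ℝ, F) p).symm y) :=
      (extChartAt 𝓘(ℝ, E) (ι p)).left_inv hys
    have hft : f y ∈ (extChartAt 𝓘(ℝ, E) (ι p)).target :=
      (extChartAt 𝓘(ℝ, E) (ι p)).map_source hys
    have hfd : MDifferentiableAt 𝓘(ℝ, F) 𝓘(ℝ, E) f y := by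
      refine MDifferentiableAt.comp y (g := extChartAt 𝓘(ℝ, E) (ι p))
        (mdifferentiableAt_extChartAt (by simpa using hys)) ?_
      exact ((hι _).mdifferentiableAt (by simp)).comp y (mdifferentiableAt_extChartAt_symm hyt)
    have e1 := mfderiv_comp y (mdifferentiableAt_extChartAt_symm hft) hfd
    have e2 := mfderiv_comp y ((hι _).mdifferentiableAt (by simp))
      (mdifferentiableAt_extChartAt_symm hyt)
    have e3 : (extChartAt 𝓘(ℝ, E) (ι p)).symm ∘ f =ᶠ[𝓝 y] ι ∘ (extChartAt 𝓘(ℝ, F) p).symm := by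
      filter_upwards [hy] with z hz
      exact (extChartAt 𝓘(ℝ, E) (ι p)).left_inv hz.2
    have e4 := e3.mfderiv_eq (I := 𝓘(ℝ, F)) (I' := 𝓘(ℝ, E))
    ext v
    -- With `covectorToModel` the codomain no longer depends on the base point, so `hx` can be
    -- rewritten.
    change covectorToModel α _ (mfderiv 𝓘(ℝ, F) 𝓘(ℝ, E) ι _
        (mfderiv 𝓘(ℝ, F) 𝓘(ℝ, F) (extChartAt 𝓘(ℝ, F) p).symm y (v 0))) =
      covectorToModel α _ (mfderiv 𝓘(ℝ, E) 𝓘(ℝ, E) (extChartAt 𝓘(ℝ, E) (ι p)).symm (f y)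
        (fderiv ℝ f y (v 0)))
    rw [hx, ← mfderiv_eq_fderiv]
    congr 1
    have h1 := DFunLike.congr_fun e1 (v 0)
    have h2 := DFunLike.congr_fun e2 (v 0)
    have h4 := DFunLike.congr_fun e4 (v 0)
    exact h2.symm.trans (h4.symm.trans h1)
  have hω : DifferentiableAt ℝ (formInChart α (ι p)) (f y₀) := by
    rw [hfy₀]
    exact (hα.contDiffAt_formInChart (ι p)).differentiableAt (by simp)
  have hpull := extDeriv_pullback hω hfs.contDiffAt (r := ∞)
    (by rw [minSmoothness_of_isRCLikeNormedField]; exact WithTop.coe_le_coe.mpr le_top)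
  ext v
  -- Chain rule for `f ∘ chart = chart ∘ ι` near `p`.
  have e5 : (fderiv ℝ f y₀) ∘L (mfderiv 𝓘(ℝ, F) 𝓘(ℝ, F) (extChartAt 𝓘(ℝ, F) p) p) =
      (mfderiv 𝓘(ℝ, E) 𝓘(ℝ, E) (extChartAt 𝓘(ℝ, E) (ι p)) (ι p)) ∘L
        (mfderiv 𝓘(ℝ, F) 𝓘(ℝ, E) ι p) := by
    rw [← mfderiv_eq_fderiv]
    have a1 := mfderiv_comp p (hfs.mdifferentiableAt (by simp))
      (mdifferentiableAt_extChartAt (I := 𝓘(ℝ, F)) (mem_chart_source F p))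
    have a2 := mfderiv_comp p (mdifferentiableAt_extChartAt (I := 𝓘(ℝ, E)) (mem_chart_source E (ι p)))
      ((hι p).mdifferentiableAt (by simp))
    have a3 : f ∘ extChartAt 𝓘(ℝ, F) p =ᶠ[𝓝 p] extChartAt 𝓘(ℝ, E) (ι p) ∘ ι := by
      filter_upwards [extChartAt_source_mem_nhds (I := 𝓘(ℝ, F)) p] with z hz
      simp only [hf, Function.comp_apply, (extChartAt 𝓘(ℝ, F) p).left_inv hz]
    exact a1.symm.trans ((a3.mfderiv_eq (I := 𝓘(ℝ, F)) (I' := 𝓘(ℝ, E))).trans a2)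
  have e6 : extDeriv (formInChart (pullbackForm (F := F) ι α) p) y₀ =
      (extDeriv (formInChart α (ι p)) (extChartAt 𝓘(ℝ, E) (ι p) (ι p))).compContinuousLinearMap
        (fderiv ℝ f y₀) := by
    rw [hform.extDeriv_eq, hpull, hfy₀]
  change extDeriv (formInChart (pullbackForm (F := F) ι α) p) y₀ _ =
    extDeriv (formInChart α (ι p)) (extChartAt 𝓘(ℝ, E) (ι p) (ι p)) _
  rw [e6]
  change extDeriv (formInChart α (ι p)) (extChartAt 𝓘(ℝ, E) (ι p) (ι p)) _ = _
  congr 1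
  ext i
  exact DFunLike.congr_fun e5 (v i)

end Pullback

/-! ### Smoothness of tensor fields in local trivializations. -/

section Coordinates

open Filter Topology

variable {E : Type*} [NormedAddCommGroup E] [NormedSpace ℝ E]
  {M : Type*} [TopologicalSpace M] [ChartedSpace E M] [IsManifold 𝓘(ℝ, E) ∞ M]

/-- The coordinates of tangent vectors at `x` in the preferred trivialization at `x₀`. -/
def toCoord (x₀ x : M) : TangentSpace 𝓘(ℝ, E) x →L[ℝ] E :=
  (trivializationAt E (TangentSpace 𝓘(ℝ, E)) x₀).continuousLinearMapAt ℝ x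

/-- The tangent vector at `x` with given coordinates in the preferred trivialization at `x₀`. -/
def ofCoord (x₀ x : M) : E →L[ℝ] TangentSpace 𝓘(ℝ, E) x :=
  (trivializationAt E (TangentSpace 𝓘(ℝ, E)) x₀).symmL ℝ x

/-- The domain of the preferred trivialization of the tangent bundle at `x₀`. -/
abbrev coordDomain (x₀ : M) : Set M :=
  (trivializationAt E (TangentSpace 𝓘(ℝ, E) : M → Type _) x₀).baseSet

lemma coordDomain_mem_nhds (x₀ : M) : coordDomain (E := E) x₀ ∈ 𝓝 x₀ :=
  (trivializationAt E (TangentSpace 𝓘(ℝ, E) : M → Type _) x₀).open_baseSet.mem_nhds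
    (mem_baseSet_trivializationAt E _ x₀)

lemma ofCoord_toCoord {x₀ x : M} (hx : x ∈ coordDomain (E := E) x₀) (v : TangentSpace 𝓘(ℝ, E) x) :
    ofCoord x₀ x (toCoord x₀ x v) = v :=
  Trivialization.symmL_continuousLinearMapAt _ hx v

lemma toCoord_ofCoord {x₀ x : M} (hx : x ∈ coordDomain (E := E) x₀) (v : E) :
    toCoord x₀ x (ofCoord x₀ x v) = v :=
  Trivialization.continuousLinearMapAt_symmL _ hx v

lemma toCoord_injective {x₀ x : M} (hx : x ∈ coordDomain (E := E) x₀) :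
    Function.Injective (toCoord (E := E) x₀ x) :=
  Function.LeftInverse.injective (ofCoord_toCoord hx)

lemma contMDiffAt_vectorField_iff (Z : ∀ x : M, TangentSpace 𝓘(ℝ, E) x) (x₀ : M) :
    ContMDiffAt 𝓘(ℝ, E) (𝓘(ℝ, E).prod 𝓘(ℝ, E)) ∞
      (fun x ↦ TotalSpace.mk' E (E := fun x : M ↦ TangentSpace 𝓘(ℝ, E) x) x (Z x)) x₀ ↔
    ContMDiffAt 𝓘(ℝ, E) 𝓘(ℝ, E) ∞ (fun x ↦ toCoord x₀ x (Z x)) x₀ := by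
  rw [contMDiffAt_section]
  refine EventuallyEq.contMDiffAt_iff ?_
  filter_upwards [coordDomain_mem_nhds (E := E) x₀] with x hx
  rw [toCoord, Trivialization.continuousLinearMapAt_apply,
    Trivialization.coe_linearMapAt_of_mem _ hx]

lemma contMDiffAt_oneForm_iff (α : ∀ x : M, TangentSpace 𝓘(ℝ, E) x →L[ℝ] ℝ) (x₀ : M) :
    ContMDiffAt 𝓘(ℝ, E) (𝓘(ℝ, E).prod 𝓘(ℝ, E →L[ℝ] ℝ)) ∞
      (fun x ↦ TotalSpace.mk' (E →L[ℝ] ℝ)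
        (E := fun x : M ↦ TangentSpace 𝓘(ℝ, E) x →L[ℝ] Trivial M ℝ x) x (α x)) x₀ ↔
    ContMDiffAt 𝓘(ℝ, E) 𝓘(ℝ, E →L[ℝ] ℝ) ∞ (fun x ↦ (α x).comp (ofCoord x₀ x)) x₀ := by
  refine (contMDiffAt_hom_bundle _).trans ((and_iff_right contMDiffAt_id).trans ?_)
  refine EventuallyEq.contMDiffAt_iff (Eventually.of_forall fun x ↦ ?_)
  ext v
  simp [ContinuousLinearMap.inCoordinates]
  rfl

lemma contMDiffAt_endomorphismField_iff
    (φ : ∀ x : M, TangentSpace 𝓘(ℝ, E) x →L[ℝ] TangentSpace 𝓘(ℝ, E) x) (x₀ : M) :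
    ContMDiffAt 𝓘(ℝ, E) (𝓘(ℝ, E).prod 𝓘(ℝ, E →L[ℝ] E)) ∞
      (fun x ↦ TotalSpace.mk' (E →L[ℝ] E)
        (E := fun x : M ↦ TangentSpace 𝓘(ℝ, E) x →L[ℝ] TangentSpace 𝓘(ℝ, E) x) x (φ x)) x₀ ↔
    ContMDiffAt 𝓘(ℝ, E) 𝓘(ℝ, E →L[ℝ] E) ∞
      (fun x ↦ (toCoord x₀ x).comp ((φ x).comp (ofCoord x₀ x))) x₀ := by
  refine (contMDiffAt_hom_bundle _).trans ((and_iff_right contMDiffAt_id).trans ?_)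
  rfl

/-- The matrix of a bilinear form in the preferred trivialization at `x₀`. -/
def bilinInCoord (g : ∀ x : M, TangentSpace 𝓘(ℝ, E) x →L[ℝ] TangentSpace 𝓘(ℝ, E) x →L[ℝ] ℝ)
    (x₀ x : M) : E →L[ℝ] E →L[ℝ] ℝ :=
  ContinuousLinearMap.inCoordinates E (TangentSpace 𝓘(ℝ, E)) (E →L[ℝ] ℝ)
    (fun x : M ↦ TangentSpace 𝓘(ℝ, E) x →L[ℝ] Trivial M ℝ x) x₀ x x₀ x (g x)

lemma bilinInCoord_apply
    (g : ∀ x : M, TangentSpace 𝓘(ℝ, E) x →L[ℝ] TangentSpace 𝓘(ℝ, E) x →L[ℝ] ℝ)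
    {x₀ x : M} (hx : x ∈ coordDomain (E := E) x₀) (v w : E) :
    bilinInCoord g x₀ x v w = g x (ofCoord x₀ x v) (ofCoord x₀ x w) := by
  rw [bilinInCoord, inCoordinates_apply_eq₂ hx hx (by simp)]
  simp [ofCoord, Trivialization.symmL_apply _ hx]

lemma contMDiffAt_bilin_iff
    (g : ∀ x : M, TangentSpace 𝓘(ℝ, E) x →L[ℝ] TangentSpace 𝓘(ℝ, E) x →L[ℝ] ℝ) (x₀ : M) :
    ContMDiffAt 𝓘(ℝ, E) (𝓘(ℝ, E).prod 𝓘(ℝ, E →L[ℝ] E →L[ℝ] ℝ)) ∞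
      (fun x ↦ TotalSpace.mk' (E →L[ℝ] E →L[ℝ] ℝ)
        (E := fun x : M ↦ TangentSpace 𝓘(ℝ, E) x →L[ℝ] TangentSpace 𝓘(ℝ, E) x →L[ℝ] ℝ) x (g x)) x₀ ↔
    ContMDiffAt 𝓘(ℝ, E) 𝓘(ℝ, E →L[ℝ] E →L[ℝ] ℝ) ∞ (bilinInCoord g x₀) x₀ := by
  refine (contMDiffAt_hom_bundle _).trans ((and_iff_right contMDiffAt_id).trans ?_)
  rfl

end Coordinates

/-! ### Pulled-back bilinear forms and smooth left inverses. -/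

section Restriction

open Filter Topology

variable {E : Type*} [NormedAddCommGroup E] [NormedSpace ℝ E]
  {M : Type*} [TopologicalSpace M] [ChartedSpace E M]
  {F : Type*} [NormedAddCommGroup F] [NormedSpace ℝ F]
  {L : Type*} [TopologicalSpace L] [ChartedSpace F L]

/-- The restriction of a bilinear form under `ι`. -/
def pullbackBilin (ι : L → M)
    (g : ∀ x : M, TangentSpace 𝓘(ℝ, E) x →L[ℝ] TangentSpace 𝓘(ℝ, E) x →L[ℝ] ℝ) (p : L) :
    TangentSpace 𝓘(ℝ, F) p →L[ℝ] TangentSpace 𝓘(ℝ, F) p →L[ℝ] ℝ :=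
  (((ContinuousLinearMap.compL ℝ F E ℝ).flip (mfderiv 𝓘(ℝ, F) 𝓘(ℝ, E) ι p)).comp
    ((show E →L[ℝ] E →L[ℝ] ℝ from g (ι p)).comp
      (show F →L[ℝ] E from mfderiv 𝓘(ℝ, F) 𝓘(ℝ, E) ι p)) : F →L[ℝ] F →L[ℝ] ℝ)

lemma pullbackBilin_apply
    (g : ∀ x : M, TangentSpace 𝓘(ℝ, E) x →L[ℝ] TangentSpace 𝓘(ℝ, E) x →L[ℝ] ℝ) (p : L)
    (v w : TangentSpace 𝓘(ℝ, F) p) :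
    pullbackBilin ι g p v w =
      g (ι p) (mfderiv 𝓘(ℝ, F) 𝓘(ℝ, E) ι p v) (mfderiv 𝓘(ℝ, F) 𝓘(ℝ, E) ι p w) := rfl

/-- An injective continuous linear map depending smoothly on a point has, locally, a left inverse
depending smoothly on the point. -/
lemma exists_contMDiffAt_leftInverse [FiniteDimensional ℝ E] [FiniteDimensional ℝ F]
    {A : L → F →L[ℝ] E} {p₀ : L} (hA : ContMDiffAt 𝓘(ℝ, F) 𝓘(ℝ, F →L[ℝ] E) ∞ A p₀)
    (hinj : Function.Injective (A p₀)) :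
    ∃ D : L → E →L[ℝ] F, ContMDiffAt 𝓘(ℝ, F) 𝓘(ℝ, E →L[ℝ] F) ∞ D p₀ ∧
      ∀ᶠ p in 𝓝 p₀, ∀ v, D p (A p v) = v := by
  have : CompleteSpace F := FiniteDimensional.complete ℝ F
  obtain ⟨B', hB'⟩ := LinearMap.exists_leftInverse_of_injective (A p₀).toLinearMap
    (LinearMap.ker_eq_bot.mpr hinj)
  -- With `B` a fixed left inverse of `A p₀`, the family of left inverses is `(B ∘ A p)⁻¹ ∘ B`; it
  -- is smooth because inversion is smooth at the identity `B ∘ A p₀`.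
  let B : E →L[ℝ] F := LinearMap.toContinuousLinearMap B'
  have hB : B.comp (A p₀) = ContinuousLinearEquiv.refl ℝ F := by
    ext v
    exact DFunLike.congr_fun hB' v
  have hBA : ContMDiffAt 𝓘(ℝ, F) 𝓘(ℝ, F →L[ℝ] F) ∞ (fun p ↦ B.comp (A p)) p₀ :=
    contMDiffAt_const.clm_comp hA
  have hinv : ContMDiffAt 𝓘(ℝ, F) 𝓘(ℝ, F →L[ℝ] F) ∞
      (fun p ↦ ContinuousLinearMap.inverse (B.comp (A p))) p₀ := by
    refine ContDiffAt.comp_contMDiffAt (g := ContinuousLinearMap.inverse) ?_ hBA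
    rw [hB]
    exact contDiffAt_map_inverse _
  refine ⟨fun p ↦ (ContinuousLinearMap.inverse (B.comp (A p))).comp B,
    hinv.clm_comp contMDiffAt_const, ?_⟩
  -- `ContinuousLinearMap.inverse` is a genuine inverse only on isomorphisms; these form a
  -- neighbourhood of the identity.
  have hnhds : range ((↑) : (F ≃L[ℝ] F) → F →L[ℝ] F) ∈ 𝓝 (B.comp (A p₀)) := by
    rw [hB]
    exact ContinuousLinearEquiv.nhds _
  filter_upwards [hBA.continuousAt hnhds] with p hp v
  obtain ⟨e, he⟩ := hp
  change (e : F →L[ℝ] F) = B.comp (A p) at he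
  change (ContinuousLinearMap.inverse (B.comp (A p))) ((B.comp (A p)) v) = v
  rw [← he]
  simp

end Restriction

/-! ### Restricting fields and metrics to an immersed submanifold. -/

section Immersion

open Filter Topology

variable {E : Type*} [NormedAddCommGroup E] [NormedSpace ℝ E]
  {M : Type*} [TopologicalSpace M] [ChartedSpace E M] [IsManifold 𝓘(ℝ, E) ∞ M]
  {F : Type*} [NormedAddCommGroup F] [NormedSpace ℝ F]
  {L : Type*} [TopologicalSpace L] [ChartedSpace F L] [IsManifold 𝓘(ℝ, F) ∞ L]
  {ι : L → M}

/-- The derivative of `ι` at `p` in the preferred trivializations at `p₀` and `ι p₀`. -/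
def mfderivInCoord (ι : L → M) (p₀ p : L) : F →L[ℝ] E :=
  (toCoord (ι p₀) (ι p)).comp ((mfderiv 𝓘(ℝ, F) 𝓘(ℝ, E) ι p).comp (ofCoord p₀ p))

lemma contMDiffAt_mfderivInCoord (hι : ContMDiff 𝓘(ℝ, F) 𝓘(ℝ, E) ∞ ι) (p₀ : L) :
    ContMDiffAt 𝓘(ℝ, F) 𝓘(ℝ, F →L[ℝ] E) ∞ (mfderivInCoord (E := E) (F := F) ι p₀) p₀ :=
  (hι p₀).mfderiv_const (m := ∞) (by simp)

lemma eventually_mem_coordDomain (hι : ContMDiff 𝓘(ℝ, F) 𝓘(ℝ, E) ∞ ι) (p₀ : L) :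
    ∀ᶠ p in 𝓝 p₀, p ∈ coordDomain (E := F) p₀ ∧ ι p ∈ coordDomain (E := E) (ι p₀) :=
  Filter.Eventually.and (coordDomain_mem_nhds p₀)
    ((hι p₀).continuousAt (coordDomain_mem_nhds (ι p₀)))

lemma ofCoord_mfderivInCoord {p₀ p : L} (hp : ι p ∈ coordDomain (E := E) (ι p₀)) (v : F) :
    ofCoord (ι p₀) (ι p) (mfderivInCoord (E := E) ι p₀ p v) =
      mfderiv 𝓘(ℝ, F) 𝓘(ℝ, E) ι p (ofCoord p₀ p v) :=
  ofCoord_toCoord hp _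

lemma mfderivInCoord_toCoord {p₀ p : L} (hp : p ∈ coordDomain (E := F) p₀)
    (v : TangentSpace 𝓘(ℝ, F) p) :
    mfderivInCoord (E := E) ι p₀ p (toCoord p₀ p v) =
      toCoord (ι p₀) (ι p) (mfderiv 𝓘(ℝ, F) 𝓘(ℝ, E) ι p v) := by
  simp only [mfderivInCoord, ContinuousLinearMap.comp_apply, ofCoord_toCoord hp]

lemma isSmoothOneForm_pullbackForm {α : ∀ x : M, TangentSpace 𝓘(ℝ, E) x →L[ℝ] ℝ}
    (hα : IsSmoothOneForm α) (hι : ContMDiff 𝓘(ℝ, F) 𝓘(ℝ, E) ∞ ι) :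
    IsSmoothOneForm (pullbackForm (F := F) ι α) := by
  intro p₀
  rw [contMDiffAt_oneForm_iff]
  have h := ((contMDiffAt_oneForm_iff α (ι p₀)).mp (hα _)).comp p₀ (hι p₀)
  refine (h.clm_comp (contMDiffAt_mfderivInCoord hι p₀)).congr_of_eventuallyEq ?_
  filter_upwards [eventually_mem_coordDomain hι p₀] with p hp
  ext v
  exact congrArg (α (ι p)) (ofCoord_mfderivInCoord hp.2 v).symm

lemma exists_contMDiffAt_leftInverse_mfderivInCoord [FiniteDimensional ℝ E] [FiniteDimensional ℝ F]
    (hι : ContMDiff 𝓘(ℝ, F) 𝓘(ℝ, E) ∞ ι)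
    (hinj : ∀ p, Function.Injective (mfderiv 𝓘(ℝ, F) 𝓘(ℝ, E) ι p)) (p₀ : L) :
    ∃ D : L → E →L[ℝ] F, ContMDiffAt 𝓘(ℝ, F) 𝓘(ℝ, E →L[ℝ] F) ∞ D p₀ ∧
      ∀ᶠ p in 𝓝 p₀, ∀ v, D p (mfderivInCoord ι p₀ p v) = v := by
  refine exists_contMDiffAt_leftInverse (contMDiffAt_mfderivInCoord hι p₀) ?_
  refine (toCoord_injective (mem_of_mem_nhds (coordDomain_mem_nhds (ι p₀)))).comp
    ((hinj p₀).comp (Function.LeftInverse.injective (g := toCoord p₀ p₀) ?_))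
  exact toCoord_ofCoord (mem_of_mem_nhds (coordDomain_mem_nhds p₀))

/-- In coordinates `Z'` is locally `D` applied to `Z ∘ ι`, with `D` the smooth left inverse of `dι`.
-/
lemma isSmoothVectorField_of_mfderiv_eq [FiniteDimensional ℝ E] [FiniteDimensional ℝ F]
    {Z : ∀ x : M, TangentSpace 𝓘(ℝ, E) x} (hZ : IsSmoothVectorField Z)
    (hι : ContMDiff 𝓘(ℝ, F) 𝓘(ℝ, E) ∞ ι)
    (hinj : ∀ p, Function.Injective (mfderiv 𝓘(ℝ, F) 𝓘(ℝ, E) ι p))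
    {Z' : ∀ p : L, TangentSpace 𝓘(ℝ, F) p}
    (hZ' : ∀ p, mfderiv 𝓘(ℝ, F) 𝓘(ℝ, E) ι p (Z' p) = Z (ι p)) :
    IsSmoothVectorField Z' := by
  intro p₀
  rw [contMDiffAt_vectorField_iff]
  obtain ⟨D, hD, hDA⟩ := exists_contMDiffAt_leftInverse_mfderivInCoord hι hinj p₀
  have h := ((contMDiffAt_vectorField_iff Z (ι p₀)).mp (hZ _)).comp p₀ (hι p₀)
  refine (hD.clm_apply h).congr_of_eventuallyEq ?_
  filter_upwards [eventually_mem_coordDomain hι p₀, hDA] with p hp hDAp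
  simp only [Function.comp_apply]
  rw [← hZ' p, ← mfderivInCoord_toCoord hp.1, hDAp]

/-- In coordinates `φ'` is locally `D ∘ φ ∘ dι`. -/
lemma isSmoothEndomorphismField_of_mfderiv_eq [FiniteDimensional ℝ E] [FiniteDimensional ℝ F]
    {φ : ∀ x : M, TangentSpace 𝓘(ℝ, E) x →L[ℝ] TangentSpace 𝓘(ℝ, E) x}
    (hφ : IsSmoothEndomorphismField φ) (hι : ContMDiff 𝓘(ℝ, F) 𝓘(ℝ, E) ∞ ι)
    (hinj : ∀ p, Function.Injective (mfderiv 𝓘(ℝ, F) 𝓘(ℝ, E) ι p))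
    {φ' : ∀ p : L, TangentSpace 𝓘(ℝ, F) p →L[ℝ] TangentSpace 𝓘(ℝ, F) p}
    (hφ' : ∀ p v, mfderiv 𝓘(ℝ, F) 𝓘(ℝ, E) ι p (φ' p v) =
      φ (ι p) (mfderiv 𝓘(ℝ, F) 𝓘(ℝ, E) ι p v)) :
    IsSmoothEndomorphismField φ' := by
  intro p₀
  rw [contMDiffAt_endomorphismField_iff]
  obtain ⟨D, hD, hDA⟩ := exists_contMDiffAt_leftInverse_mfderivInCoord hι hinj p₀
  have h := ((contMDiffAt_endomorphismField_iff φ (ι p₀)).mp (hφ _)).comp p₀ (hι p₀)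
  refine (hD.clm_comp (h.clm_comp (contMDiffAt_mfderivInCoord hι p₀))).congr_of_eventuallyEq ?_
  filter_upwards [eventually_mem_coordDomain hι p₀, hDA] with p hp hDAp
  ext v
  simp only [Function.comp_apply, ContinuousLinearMap.comp_apply]
  rw [ofCoord_mfderivInCoord hp.2, ← hφ' p, ← mfderivInCoord_toCoord hp.1, hDAp]

/-- By compactness `b` has a positive minimum `c` on the unit sphere, so `c ‖v‖² ≤ b v v` and the
unit ball of `b` is bounded. -/
lemma isVonNBounded_of_pos [FiniteDimensional ℝ F] (b : F →L[ℝ] F →L[ℝ] ℝ)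
    (hpos : ∀ v, v ≠ 0 → 0 < b v v) : Bornology.IsVonNBounded ℝ {v : F | b v v < 1} := by
  rw [NormedSpace.isVonNBounded_iff]
  have : ProperSpace F := FiniteDimensional.proper_real F
  have hcont : Continuous fun v : F ↦ b v v := by fun_prop
  rcases subsingleton_or_nontrivial F with hF | hF
  · exact (Set.toFinite _).isBounded
  obtain ⟨u, hu, hmin⟩ := (isCompact_sphere (0 : F) 1).exists_isMinOn
    (NormedSpace.sphere_nonempty.mpr zero_le_one) hcont.continuousOn
  have hu1 : ‖u‖ = 1 := by simpa using hu
  have hc : 0 < b u u := hpos u (by rintro rfl; simp at hu1)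
  have key (v : F) : b u u * ‖v‖ ^ 2 ≤ b v v := by
    rcases eq_or_ne v 0 with rfl | hv
    · simp
    have hn : ‖v‖ ≠ 0 := norm_ne_zero_iff.mpr hv
    have h1 : b u u ≤ b (‖v‖⁻¹ • v) (‖v‖⁻¹ • v) := hmin (by simp [norm_smul, hn])
    have h2 : b v v = ‖v‖ ^ 2 * b (‖v‖⁻¹ • v) (‖v‖⁻¹ • v) := by
      simp only [map_smul, smul_apply, smul_eq_mul]
      field_simp
    rw [h2, mul_comm]
    exact mul_le_mul_of_nonneg_left h1 (sq_nonneg _)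
  refine isBounded_iff_forall_norm_le.mpr ⟨(b u u)⁻¹ + 1, fun v hv ↦ ?_⟩
  have h3 : b u u * ‖v‖ ^ 2 < 1 := (key v).trans_lt hv
  have h4 : ‖v‖ ^ 2 ≤ (b u u)⁻¹ := by
    rw [← one_div, le_div_iff₀ hc]
    linarith
  nlinarith [norm_nonneg v, inv_pos.mpr hc]

/-- The restriction of a Riemannian metric to an immersed submanifold. -/
def pullbackMetric [FiniteDimensional ℝ F] (hι : ContMDiff 𝓘(ℝ, F) 𝓘(ℝ, E) ∞ ι)
    (hinj : ∀ p, Function.Injective (mfderiv 𝓘(ℝ, F) 𝓘(ℝ, E) ι p))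
    (g : ContMDiffRiemannianMetric 𝓘(ℝ, E) ∞ E (fun x : M ↦ TangentSpace 𝓘(ℝ, E) x)) :
    ContMDiffRiemannianMetric 𝓘(ℝ, F) ∞ F (fun p : L ↦ TangentSpace 𝓘(ℝ, F) p) where
  inner := pullbackBilin ι g.inner
  symm p v w := g.symm (ι p) _ _
  pos p v hv := g.pos (ι p) _ ((map_ne_zero_iff _ (hinj p)).mpr hv)
  isVonNBounded p := isVonNBounded_of_pos (F := F) (pullbackBilin ι g.inner p)
    fun v hv ↦ g.pos (ι p) _ ((map_ne_zero_iff _ (hinj p)).mpr hv)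
  contMDiff := by
    intro p₀
    rw [contMDiffAt_bilin_iff]
    have hA := contMDiffAt_mfderivInCoord hι p₀
    have h := ((contMDiffAt_bilin_iff g.inner (ι p₀)).mp (g.contMDiff _)).comp p₀ (hι p₀)
    -- Precomposition with `A` is the transpose factor in the coordinate formula `Aᵀ g A` for the
    -- restricted metric.
    have hA' := hA.clm_precomp (F₃ := ℝ)
    refine (hA'.clm_comp (h.clm_comp hA)).congr_of_eventuallyEq ?_
    filter_upwards [eventually_mem_coordDomain hι p₀] with p hp
    ext v w
    rw [bilinInCoord_apply _ hp.1, pullbackBilin_apply, ← ofCoord_mfderivInCoord hp.2,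
      ← ofCoord_mfderivInCoord hp.2, ← bilinInCoord_apply _ hp.2]
    rfl

end Immersion

/-! ### The contact metric structure on an integral manifold. -/

section Leaf

lemma exists_restrict_endomorphism {V W : Type*} [NormedAddCommGroup V] [NormedSpace ℝ V]
    [FiniteDimensional ℝ V] [NormedAddCommGroup W] [NormedSpace ℝ W] (A : V →L[ℝ] W)
    (hA : Function.Injective A) (T : W →L[ℝ] W) (hT : ∀ v, T (A v) ∈ LinearMap.range A.toLinearMap) :
    ∃ S : V →L[ℝ] V, ∀ v, A (S v) = T (A v) := by
  obtain ⟨B, hB⟩ := LinearMap.exists_leftInverse_of_injective A.toLinearMap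
    (LinearMap.ker_eq_bot.mpr hA)
  refine ⟨LinearMap.toContinuousLinearMap (B ∘ₗ T.toLinearMap ∘ₗ A.toLinearMap), fun v ↦ ?_⟩
  obtain ⟨u, hu⟩ := hT v
  have hBu : B (A u) = u := DFunLike.congr_fun hB u
  change A u = T (A v) at hu
  change A (B (T (A v))) = T (A v)
  rw [← hu, hBu]

variable {E : Type*} [NormedAddCommGroup E] [NormedSpace ℝ E] [FiniteDimensional ℝ E]
  {M : Type*} [TopologicalSpace M] [ChartedSpace E M] [IsManifold 𝓘(ℝ, E) ∞ M]
  {F : Type*} [NormedAddCommGroup F] [NormedSpace ℝ F] [FiniteDimensional ℝ F]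
  {L : Type*} [TopologicalSpace L] [ChartedSpace F L] [IsManifold 𝓘(ℝ, F) ∞ L]
  {ι : L → M}

/-- A Reeb field and an endomorphism field that are tangent to an integral manifold of a
distribution `D`, and satisfy the identities of a contact metric structure along `D`, induce a
contact metric structure on that integral manifold. -/
lemma IsIntegralManifold.inducesContactMetricStructure
    {D : ∀ x : M, Submodule ℝ (TangentSpace 𝓘(ℝ, E) x)}
    {α : ∀ x : M, TangentSpace 𝓘(ℝ, E) x →L[ℝ] ℝ} {Z : ∀ x : M, TangentSpace 𝓘(ℝ, E) x}
    {φ : ∀ x : M, TangentSpace 𝓘(ℝ, E) x →L[ℝ] TangentSpace 𝓘(ℝ, E) x}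
    {g : ContMDiffRiemannianMetric 𝓘(ℝ, E) ∞ E (fun x : M ↦ TangentSpace 𝓘(ℝ, E) x)}
    (hι : IsIntegralManifold (F := F) D ι) (hα : IsSmoothOneForm α) (hZ : IsReebField α Z)
    (hφ : IsSmoothEndomorphismField φ) (hZD : ∀ x, Z x ∈ D x) (hφD : ∀ x, ∀ v ∈ D x, φ x v ∈ D x)
    (hsq : ∀ x, ∀ v ∈ D x, φ x (φ x v) = -v + α x v • Z x) (hφZ : ∀ x, φ x (Z x) = 0)
    (hgφ : ∀ x, ∀ v ∈ D x, ∀ w, g.inner x v (φ x w) = extDerivForm α x ![v, w])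
    (hgZ : ∀ x v, g.inner x v (Z x) = α x v) :
    InducesContactMetricStructure (F := F) ι α Z φ g := by
  have hD (p : L) (v : TangentSpace 𝓘(ℝ, F) p) : mfderiv 𝓘(ℝ, F) 𝓘(ℝ, E) ι p v ∈ D (ι p) := by
    rw [← hι.range_mfderiv p]
    exact ⟨v, rfl⟩
  have hZr (p : L) : ∃ v, mfderiv 𝓘(ℝ, F) 𝓘(ℝ, E) ι p v = Z (ι p) := by
    have h := hZD (ι p)
    rw [← hι.range_mfderiv p] at h
    exact h
  have hφr (p : L) : ∃ S : TangentSpace 𝓘(ℝ, F) p →L[ℝ] TangentSpace 𝓘(ℝ, F) p,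
      ∀ v, mfderiv 𝓘(ℝ, F) 𝓘(ℝ, E) ι p (S v) = φ (ι p) (mfderiv 𝓘(ℝ, F) 𝓘(ℝ, E) ι p v) := by
    refine exists_restrict_endomorphism (V := F) (W := E) (mfderiv 𝓘(ℝ, F) 𝓘(ℝ, E) ι p)
      (hι.injective_mfderiv p) (φ (ι p)) fun v ↦ ?_
    have h := hφD (ι p) _ (hD p v)
    rw [← hι.range_mfderiv p] at h
    exact h
  choose Z' hZ' using hZr
  choose φ' hφ' using hφr
  have hinj := hι.injective_mfderiv
  have hdα (p : L) (v w : TangentSpace 𝓘(ℝ, F) p) :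
      extDerivForm (pullbackForm (F := F) ι α) p ![v, w] = extDerivForm α (ι p)
        ![mfderiv 𝓘(ℝ, F) 𝓘(ℝ, E) ι p v, mfderiv 𝓘(ℝ, F) 𝓘(ℝ, E) ι p w] := by
    rw [extDerivForm_pullbackForm hα hι.smooth]
    refine congrArg (extDerivForm α (ι p)) ?_
    ext i
    fin_cases i <;> rfl
  have hαs := isSmoothOneForm_pullbackForm hα hι.smooth
  have hZs := isSmoothVectorField_of_mfderiv_eq hZ.smooth hι.smooth hinj hZ'
  have hαZ (p : L) : pullbackForm (F := F) ι α p (Z' p) = 1 :=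
    (congrArg (α (ι p)) (hZ' p)).trans (hZ.apply_self (ι p))
  have hcontr (p : L) (w) : extDerivForm (pullbackForm (F := F) ι α) p ![Z' p, w] = 0 := by
    rw [hdα, hZ', hZ.contraction]
  have hsq' (p : L) (v) : φ' p (φ' p v) = -v + pullbackForm (F := F) ι α p v • Z' p := by
    apply hinj p
    rw [hφ', hφ', hsq _ _ (hD p v), map_add, map_neg, map_smul, hZ']
    rfl
  have hgφ' (p : L) (v w) : (pullbackMetric hι.smooth hinj g).inner p v (φ' p w) =
      extDerivForm (pullbackForm (F := F) ι α) p ![v, w] := by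
    rw [hdα, ← hgφ _ _ (hD p v), ← hφ']
    rfl
  have hnondeg (p : L) (v : TangentSpace 𝓘(ℝ, F) p) (hv : pullbackForm (F := F) ι α p v = 0)
      (hdv : ∀ w, extDerivForm (pullbackForm (F := F) ι α) p ![v, w] = 0) : v = 0 := by
    by_contra hne
    have hpos := (pullbackMetric hι.smooth hinj g).pos p v hne
    -- Testing `dα(v, ·)` on `φ' v` gives `g(v, φ'² v) = -g(v, v)`, against positivity.
    have h1 := (hgφ' p v (φ' p v)).trans (hdv (φ' p v))
    rw [hsq', hv, zero_smul, add_zero, map_neg] at h1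
    linarith
  have hvol (p : L) : ∃ n, Module.finrank ℝ F = 1 + 2 * n ∧
      wedge (covector (pullbackForm (F := F) ι α p).toLinearMap)
        (wedgePow (extDerivForm (pullbackForm (F := F) ι α) p).toAlternatingMap n) ≠ 0 :=
    exists_wedge_covector_wedgePow_ne_zero (V := F) _ _ (hαZ p) (hcontr p) (hnondeg p)
  refine ⟨Z', φ', pullbackMetric hι.smooth hinj g, hZ', hφ', fun p v w ↦ rfl, ?_⟩
  refine
    { almostContact :=
        { smooth_form := hαs
          smooth_field := hZs
          smooth_endo := isSmoothEndomorphismField_of_mfderiv_eq hφ hι.smooth hinj hφ'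
          sq := hsq'
          map_field := fun p ↦ hinj p (by rw [hφ', hZ', hφZ, map_zero])
          apply_field := hαZ }
      contact := ⟨hαs, ?_⟩
      reeb := ⟨hZs, hαZ, hcontr⟩
      metric_endo := hgφ'
      metric_field := fun p v ↦ ?_ }
  -- The exponent is obtained pointwise but is determined by `dim F = 1 + 2n`. A point is needed to
  -- know that `dim F` is odd; connectedness supplies one.
  · obtain ⟨p₀⟩ := hι.connected.toNonempty
    obtain ⟨n, hn, -⟩ := hvol p₀
    refine ⟨n, hn, fun p ↦ ?_⟩
    obtain ⟨m, hm, hne⟩ := hvol p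
    obtain rfl : m = n := by omega
    exact hne
  · exact (congrArg (g.inner (ι p) _) (hZ' p)).trans (hgZ _ _)

end Leaf

end ContactPairs

end

theorem mainTheorem3
    {E : Type*} [NormedAddCommGroup E] [NormedSpace ℝ E] [FiniteDimensional ℝ E]
    {M : Type*} [TopologicalSpace M] [ChartedSpace E M] [IsManifold 𝓘(ℝ, E) ∞ M]
    (h k : ℕ)
    (α₁ α₂ : ∀ x : M, TangentSpace 𝓘(ℝ, E) x →L[ℝ] ℝ)
    (Z₁ Z₂ : ∀ x : M, TangentSpace 𝓘(ℝ, E) x)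
    (φ : ∀ x : M, TangentSpace 𝓘(ℝ, E) x →L[ℝ] TangentSpace 𝓘(ℝ, E) x)
    (g : ContMDiffRiemannianMetric 𝓘(ℝ, E) ∞ E (fun x : M ↦ TangentSpace 𝓘(ℝ, E) x))
    (hM : ContactPairs.IsMetricContactPair h k α₁ α₂ Z₁ Z₂ φ g)
    (hφ : ContactPairs.IsDecomposable α₁ α₂ φ)
    {F : Type*} [NormedAddCommGroup F] [NormedSpace ℝ F] [FiniteDimensional ℝ F]
    {L : Type*} [TopologicalSpace L] [ChartedSpace F L] [IsManifold 𝓘(ℝ, F) ∞ L]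
    (ι : L → M) :
    (ContactPairs.IsLeaf (F := F) (ContactPairs.charDistribution α₂) ι →
      ContactPairs.InducesContactMetricStructure (F := F) ι α₁ Z₁ φ g) ∧
    (ContactPairs.IsLeaf (F := F) (ContactPairs.charDistribution α₁) ι →
      ContactPairs.InducesContactMetricStructure (F := F) ι α₂ Z₂ φ g) := by
  have hP := hM.pairStructure
  have hC := hP.contactPair
  have hR := hP.reeb
  refine ⟨fun hι ↦ ?_, fun hι ↦ ?_⟩
  · refine hι.toIsIntegralManifold.inducesContactMetricStructure hC.smooth₁
      ⟨hR.smooth₁, hR.apply₁₁, hR.contraction₁₁⟩ hP.smooth_endo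
      (fun x ↦ ⟨hR.apply₂₁ x, hR.contraction₁₂ x⟩) hφ.2 (fun x v hv ↦ ?_) hP.map_field₁
      (fun x v hv w ↦ ?_) hM.metric_field₁
    -- Tangency to the leaf gives `α₂ v = 0`, which removes the `Z₂` term.
    · rw [hP.sq, hv.1, zero_smul, add_zero]
    -- Tangency also gives `dα₂(v, ·) = 0`, leaving only `dα₁`.
    · exact (hM.metric_endo x v w).trans ((congrArg _ (hv.2 w)).trans (add_zero _))
  · refine hι.toIsIntegralManifold.inducesContactMetricStructure hC.smooth₂
      ⟨hR.smooth₂, hR.apply₂₂, hR.contraction₂₂⟩ hP.smooth_endo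
      (fun x ↦ ⟨hR.apply₁₂ x, hR.contraction₂₁ x⟩) hφ.1 (fun x v hv ↦ ?_) hP.map_field₂
      (fun x v hv w ↦ ?_) hM.metric_field₂
    · rw [hP.sq, hv.1, zero_smul, add_zero]
    · exact (hM.metric_endo x v w).trans ((congrArg (· + _) (hv.2 w)).trans (zero_add _))
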